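/- Let $p$ be a prime and let $G$ be a compact Lie group. A subgroup $\mathbf{P}\subseteq G$ is called $p$-toral if, as a topological group, it is an extension of a torus $(S^1)^r$, $r\ge 0$, by a finite $p$-group: it has a normal subgroup isomorphic to $(S^1)^r$ as a topological group, with quotient a finite $p$-group. A subgroup $P\subseteq G$ is called discrete $p$-toral if, as an abstract group, it is an extension of a discrete $p$-torus $(\mathbb{Z}/p^\infty)^r$, $r\ge 0$, by a finite $p$-group. A discrete $p$-toral subgroup $P\subseteq G$ is snugly embedded if it is maximal among the discrete $p$-toral subgroups of its closure $\overline{P}$. A $p$-discretization of a $p$-toral subgroup $\mathbf{P}\subseteq G$ is a snugly embedded discrete $p$-toral subgroup $P\subseteq\mathbf{P}$ with $\overline{P}=\mathbf{P}$. Let $\mathbf{Q}\subseteq\mathbf{P}$ be $p$-toral subgroups of $G$, and let $Q\subseteq P$ be such that $Q$ is a $p$-discretization of $\mathbf{Q}$ and $P$ is a $p$-discretization of $\mathbf{P}$. Then the centralizer $C_{\mathbf{P}}(\mathbf{Q})$ and the normalizer $N_{\mathbf{P}}(\mathbf{Q})$ are $p$-toral, $C_P(Q)$ is a $p$-discretization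 of $C_{\mathbf{P}}(\mathbf{Q})$, and $N_P(Q)$ is a $p$-discretization of $N_{\mathbf{P}}(\mathbf{Q})$. Consequently, if $P$ is a $p$-discretization of a $p$-toral subgroup $\mathbf{P}\subseteq G$, then the center $Z(\mathbf{P})$ is $p$-toral and $Z(P)$ is a $p$-discretization of $Z(\mathbf{P})$. -/

import Mathlib

open scoped Manifold ContDiff

/-- The rank one discrete `p`-torus `ℤ/p^∞`, the group of elements of `p`-power order
in the circle group (for a prime `p`). -/
abbrev PruferGroup (p : ℕ) : Type :=
  CommGroup.primaryComponent Circle p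

section

variable {G : Type*} [Group G]

/-- A subgroup `K` of a topological group is `p`-toral if it is (with the subspace topology)
an extension of a torus `(S¹)^r` by a finite `p`-group: it has a normal subgroup that is
isomorphic to `(S¹)^r` as a topological group, with quotient a finite `p`-group. -/
def IsPToral [TopologicalSpace G] (p : ℕ) (K : Subgroup G) : Prop :=
  ∃ (r : ℕ) (T : Subgroup K) (_ : T.Normal),
    Nonempty (T ≃ₜ* (Fin r → Circle)) ∧ Finite (K ⧸ T) ∧ IsPGroup p (K ⧸ T)

/-- A subgroup `K` of a group is a discrete `p`-toral group if it is (as an abstract group)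
an extension of a discrete `p`-torus `(ℤ/p^∞)^r` by a finite `p`-group. -/
def IsDiscretePToral (p : ℕ) (K : Subgroup G) : Prop :=
  ∃ (r : ℕ) (T : Subgroup K) (_ : T.Normal),
    Nonempty (T ≃* (Fin r → PruferGroup p)) ∧ Finite (K ⧸ T) ∧ IsPGroup p (K ⧸ T)

/-- A discrete `p`-toral subgroup `P` of a topological group is snugly embedded if it is
maximal among the discrete `p`-toral subgroups contained in the closure of `P`. -/
def IsSnuglyEmbedded [TopologicalSpace G] (p : ℕ) (P : Subgroup G) : Prop :=
  Maximal (fun H : Subgroup G => IsDiscretePToral p H ∧ (H : Set G) ⊆ closure (P : Set G)) P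

/-- `P` is a `p`-discretization of `K`: the subgroup `K` is `p`-toral, and `P` is a
snugly embedded discrete `p`-toral subgroup whose closure is `K`. -/
structure IsPDiscretization [TopologicalSpace G] (p : ℕ)
    (P K : Subgroup G) : Prop where
  isPToral : IsPToral p K
  isDiscretePToral : IsDiscretePToral p P
  isSnuglyEmbedded : IsSnuglyEmbedded p P
  closure_eq : closure (P : Set G) = (K : Set G)

/-- The centralizer `C_P(Q)` of `Q` in `P`, as a subgroup of the ambient group. -/
def centralizerIn (P Q : Subgroup G) : Subgroup G :=
  P ⊓ Subgroup.centralizer (Q : Set G)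

/-- The normalizer `N_P(Q)` of `Q` in `P`, as a subgroup of the ambient group. -/
def normalizerIn (P Q : Subgroup G) : Subgroup G :=
  P ⊓ Subgroup.normalizer (Q : Set G)

/-- The center `Z(P)` of `P`, as a subgroup of the ambient group. -/
def centerOf (P : Subgroup G) : Subgroup G :=
  (Subgroup.center P).map P.subtype

end

/-!
Only the topology of `G` matters: everything takes place in `p`-toral subgroups of a Hausdorff
topological group. Let `L` be `p`-toral with torus `T`, and `P` a `p`-discretization of `L`.
Snugness forces `P` to contain the whole `p`-power torsion of `T`
(`IsPToralExtension.mem_of_pow_eq_one`), and density forces `L = P T`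
(`IsPToralExtension.exists_mul_of_closure_eq`). Conversely, these two properties characterize
`p`-discretizations among the `p`-torsion subgroups (`IsPToralExtension.isPDiscretization`). As a
first consequence `P ⊓ K = Q` whenever `Q ≤ P` is a `p`-discretization of `K`
(`IsPDiscretization.inf_eq`), so that the centralizer and the normalizer of `Q` in `P` are the
intersections of `P` with those of `K` in `L`.

It remains to see that `P ⊓ M` is a `p`-discretization of `M` when `M` is the centralizer or the
normalizer of `K` in `L`; both cases are instances of `IsPToralExtension.isPDiscretization_inf`.
The group `Q` acts on `T` by conjugation through a finite group of order `p ^ k`, and the product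
over this group is a norm map `N : T → T` (`IsTorus.exists_norm`) whose values are fixed by `Q`.
Let `D` be trivial in the case of the centralizer, and the torus of `K` in the case of the
normalizer. Then `N(T) D` is a torus in `M`, because the image of a torus in a torus is a torus
(`isTorus_range`). Two averaging arguments finish the proof. If `x ∈ M ⊓ T`, the commutators of
`x` with `Q` have bounded `p`-power exponent modulo `D`, so some fixed `p`-power of `x` lies in
`N(T) D`, and `M` is an extension of `N(T) D` by a finite `p`-group. If `x t ∈ M` with `x ∈ P` and
`t ∈ T`, the commutators of `t` with `Q` lie in `(P ⊓ T) D`; since `D` is divisible and `P` contains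
all `p`-power torsion of `T`, the same holds for a `p ^ k`-th root `y` of `t`,
and then `N y` agrees with `t` modulo `(P ⊓ T) D`. Therefore `M = (P ⊓ M) N(T) D`.
-/

/-! ### Characters of tori -/

namespace Circle

/-- Every continuous endomorphism of the circle is a power map. It lifts along the covering
`Circle.exp` to a continuous additive, hence linear, map `ℝ → ℝ`. -/
theorem exists_eq_zpow_of_continuous (f : Circle →* Circle) (hf : Continuous f) :
    ∃ n : ℤ, ∀ z, f z = z ^ n := by
  have hlift : ∀ F : C(ℝ, Circle), ∀ e₀ : ℝ, exp e₀ = F 0 →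
      ∃! L : C(ℝ, ℝ), L 0 = e₀ ∧ exp ∘ L = F := fun F e₀ h ↦
    Circle.isCoveringMap_exp.existsUnique_continuousMap_lifts F (a₀ := 0) (e₀ := e₀) h
  let F : C(ℝ, Circle) := ⟨fun x ↦ f (exp x), by fun_prop⟩
  obtain ⟨L, ⟨hL0, hL⟩, -⟩ := hlift F 0 (by simp [F])
  have hLx (x : ℝ) : exp (L x) = f (exp x) := congrFun hL x
  -- For fixed `y`, both `L (x + y)` and `L x + L y` lift the same map of `x`.
  have hadd (x y : ℝ) : L (x + y) = L x + L y := by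
    have hu := (hlift ⟨fun x ↦ f (exp (x + y)), by fun_prop⟩ (L y)
      (by simp [hLx])).unique (y₁ := ⟨fun x ↦ L (x + y), by fun_prop⟩)
      (y₂ := ⟨fun x ↦ L x + L y, by fun_prop⟩)
      ⟨by simp, by ext x; simp [hLx]⟩ ⟨by simp [hL0], by ext x; simp [hLx, exp_add]⟩
    exact DFunLike.congr_fun hu x
  let A : ℝ →+ ℝ := ⟨⟨L, hL0⟩, hadd⟩
  have hlin (c : ℝ) : L c = c * L 1 := by
    have := map_real_smul A L.continuous c 1
    simpa [A] using this
  obtain ⟨n, hn⟩ := exp_eq_one.1 (show exp (L (2 * Real.pi)) = 1 by simp [hLx])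
  have hn1 : L 1 = n := by
    rw [hlin, mul_comm] at hn
    exact mul_right_cancel₀ (by positivity) hn
  refine ⟨n, fun z ↦ ?_⟩
  obtain ⟨x, rfl⟩ := exp_surjective z
  rw [← hLx, hlin, hn1, mul_comm, ← exp_intCast_mul]

theorem exists_pow_eq (z : Circle) {n : ℕ} (hn : n ≠ 0) : ∃ w : Circle, w ^ n = z := by
  obtain ⟨x, rfl⟩ := exp_surjective z
  refine ⟨exp (x / n), ?_⟩
  rw [← exp_natCast_mul]
  congr 1
  field_simp

theorem finite_setOf_pow_eq_one {n : ℕ} (hn : n ≠ 0) : {z : Circle | z ^ n = 1}.Finite := by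
  have : NeZero n := ⟨hn⟩
  refine Set.Finite.of_finite_image
    ((Polynomial.nthRootsFinset n (1 : ℂ)).finite_toSet.subset ?_)
    (f := fun z : Circle ↦ (z : ℂ)) Circle.coe_injective.injOn
  rintro _ ⟨z, hz, rfl⟩
  have hz' : z ^ n = 1 := hz
  simp only [Finset.mem_coe, Polynomial.mem_nthRootsFinset (Nat.pos_of_ne_zero hn)]
  rw [← Circle.coe_pow, hz', Circle.coe_one]

/-- Approximate the angle `2πa` by `2π⌊a p ^ k⌋ / p ^ k`. -/
theorem dense_setOf_exists_pow_eq_one {p : ℕ} (hp : 1 < p) :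
    Dense {z : Circle | ∃ k : ℕ, z ^ p ^ k = 1} := by
  intro z
  have hpi : 0 < Real.pi := Real.pi_pos
  obtain ⟨a, ha, rfl⟩ : ∃ a : ℝ, 0 ≤ a ∧ exp (2 * Real.pi * a) = z := by
    refine ⟨(Complex.arg z + 2 * Real.pi) / (2 * Real.pi), ?_, ?_⟩
    · have := Complex.neg_pi_lt_arg (z : ℂ)
      exact div_nonneg (by linarith) (by linarith)
    · rw [mul_div_cancel₀ _ (by positivity), exp_add_two_pi, exp_arg]
  have hlim : Filter.Tendsto (fun k : ℕ ↦ exp (2 * Real.pi *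
      ((⌊a * ((p : ℝ) ^ k)⌋₊ : ℝ) / (p : ℝ) ^ k))) Filter.atTop
      (nhds (exp (2 * Real.pi * a))) := by
    refine (Circle.exp.continuous.tendsto _).comp (Filter.Tendsto.const_mul _ ?_)
    exact (tendsto_nat_floor_mul_div_atTop ha).comp
      (tendsto_pow_atTop_atTop_of_one_lt (by exact_mod_cast hp))
  refine mem_closure_of_tendsto hlim (Filter.Eventually.of_forall fun k ↦ ⟨k, ?_⟩)
  rw [← exp_natCast_mul]
  have hp0 : (p : ℝ) ≠ 0 := by positivity
  refine exp_eq_one.2 ⟨⌊a * ((p : ℝ) ^ k)⌋₊, ?_⟩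
  push_cast
  field_simp

end Circle

/-- The continuous characters of a torus are the Laurent monomials. -/
theorem exists_eq_prod_zpow_of_continuous {ι : Type*} [Fintype ι]
    (f : (ι → Circle) →* Circle) (hf : Continuous f) :
    ∃ n : ι → ℤ, ∀ z, f z = ∏ i, z i ^ n i := by
  classical
  have h (i : ι) : ∃ n : ℤ, ∀ w, f (Pi.mulSingle i w) = w ^ n :=
    Circle.exists_eq_zpow_of_continuous (f.comp (MonoidHom.mulSingle (fun _ ↦ Circle) i))
      (hf.comp (continuous_mulSingle (A := fun _ ↦ Circle) i))
  choose n hn using h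
  refine ⟨n, fun z ↦ ?_⟩
  conv_lhs => rw [← Finset.univ_prod_mulSingle z, map_prod]
  simp [hn]

/-- A homomorphism of tori given by linearly independent characters is surjective. -/
theorem exists_prod_zpow_eq_of_linearIndependent {ι κ : Type*} [Fintype ι] [Fintype κ]
    {e : κ → ι → ℤ} (he : LinearIndependent ℤ e) (w : κ → Circle) :
    ∃ z : ι → Circle, ∀ k, ∏ i, z i ^ e k i = w k := by
  classical
  let c : (ι → ℤ) →ₗ[ℤ] (ι → ℚ) := (algebraMap ℤ ℚ).toIntAlgHom.toLinearMap.compLeft ι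
  have hc : Function.Injective c := fun v v' h ↦ by
    funext i
    have := congrFun h i
    simpa [c] using this
  have heℚ : LinearIndependent ℚ (c ∘ e) :=
    LinearIndependent.iff_fractionRing ℤ ℚ |>.1
      (he.map' c (LinearMap.ker_eq_bot.2 hc))
  obtain ⟨b, hb⟩ := (Fintype.linearCombination ℚ (c ∘ e)).exists_leftInverse_of_injective
    (LinearMap.ker_eq_bot.2 (linearIndependent_iff_injective_fintypeLinearCombination.1 heℚ))
  have hb' (k k' : κ) : b (c (e k)) k' = if k = k' then 1 else 0 := by
    have := congrFun (LinearMap.congr_fun hb (Pi.single k 1)) k'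
    simpa [Fintype.linearCombination_apply_single, Pi.single_apply, eq_comm] using this
  have hsum (k k' : κ) : ∑ i, (e k i : ℝ) * (b (Pi.single i 1) k' : ℝ) =
      if k = k' then 1 else 0 := by
    have h1 : c (e k) = ∑ i, (e k i : ℚ) • (Pi.single i (1 : ℚ) : ι → ℚ) := by
      conv_lhs => rw [← Finset.univ_sum_single (c (e k))]
      refine Finset.sum_congr rfl fun i _ ↦ ?_
      rw [← Pi.single_smul]
      simp [c]
    have h2 := hb' k k'
    rw [h1, map_sum, Finset.sum_apply] at h2
    simp only [map_smul, Pi.smul_apply, smul_eq_mul] at h2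
    have h3 := congrArg (Rat.cast : ℚ → ℝ) h2
    push_cast [apply_ite (Rat.cast : ℚ → ℝ)] at h3
    simpa [c] using h3
  choose θ hθ using fun k ↦ Circle.exp_surjective (w k)
  have hexp (g : ι → ℝ) : Circle.exp (∑ i, g i) = ∏ i, Circle.exp (g i) :=
    map_sum Circle.expHom g Finset.univ
  refine ⟨fun i ↦ Circle.exp (∑ k', θ k' * (b (Pi.single i 1) k' : ℝ)), fun k ↦ ?_⟩
  simp only [← Circle.exp_intCast_mul]
  rw [← hexp, ← hθ k]
  congr 1
  simp only [Finset.mul_sum]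
  rw [Finset.sum_comm]
  have : ∀ k', ∑ i, (e k i : ℝ) * (θ k' * (b (Pi.single i 1) k' : ℝ)) =
      θ k' * if k = k' then 1 else 0 := fun k' ↦ by
    rw [← hsum k k', Finset.mul_sum]
    exact Finset.sum_congr rfl fun i _ ↦ by ring
  simp [this]

/-- The kernel of a homomorphism of tori is cut out by linearly independent characters: a basis
of the group generated by the coordinate characters will do. -/
theorem exists_surjective_ker_eq {ι κ : Type*} [Fintype ι] [Fintype κ]
    (f : (ι → Circle) →* (κ → Circle)) (hf : Continuous f) :
    ∃ (r : ℕ) (φ : (ι → Circle) →* (Fin r → Circle)),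
      Continuous φ ∧ Function.Surjective φ ∧ φ.ker = f.ker := by
  choose n hn using fun k ↦ exists_eq_prod_zpow_of_continuous
    ((Pi.evalMonoidHom (fun _ : κ ↦ Circle) k).comp f) ((continuous_apply k).comp hf)
  let L : Submodule ℤ (ι → ℤ) := Submodule.span ℤ (Set.range n)
  let b := Module.finBasis ℤ L
  let e : Fin (Module.finrank ℤ L) → ι → ℤ := fun j ↦ b j
  have he : LinearIndependent ℤ e := b.linearIndependent.map' L.subtype L.ker_subtype
  have hspan : Submodule.span ℤ (Set.range e) = L := by
    have := congrArg (Submodule.map L.subtype) b.span_eq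
    rw [Submodule.map_span, ← Set.range_comp] at this
    rwa [Submodule.map_top, Submodule.range_subtype] at this
  -- The value at `z` of the character with exponent vector `v`, linear in `v`.
  let ev (z : ι → Circle) : (ι → ℤ) →ₗ[ℤ] Additive Circle :=
    Fintype.linearCombination ℤ fun i ↦ Additive.ofMul (z i)
  have hev (z v) : ev z v = Additive.ofMul (∏ i, z i ^ v i) := by
    simp [ev, Fintype.linearCombination_apply, ofMul_prod]
  have key (z : ι → Circle) (S : Set (ι → ℤ)) :
      Submodule.span ℤ S ≤ LinearMap.ker (ev z) ↔ ∀ v ∈ S, ∏ i, z i ^ v i = 1 := by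
    rw [Submodule.span_le]
    refine forall₂_congr fun v _ ↦ ?_
    rw [SetLike.mem_coe, LinearMap.mem_ker, hev]
    rfl
  refine ⟨_, MonoidHom.mk' (fun z j ↦ ∏ i, z i ^ e j i) fun z w ↦ ?_, ?_, fun w ↦ ?_, ?_⟩
  · funext j
    simp [mul_zpow, Finset.prod_mul_distrib]
  · exact continuous_pi fun j ↦ continuous_finsetProd _ fun i _ ↦ (continuous_apply i).zpow _
  · obtain ⟨z, hz⟩ := exists_prod_zpow_eq_of_linearIndependent he w
    exact ⟨z, funext hz⟩
  · ext z
    have h1 : f z = 1 ↔ ∀ v ∈ Set.range n, ∏ i, z i ^ v i = 1 := by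
      simp only [Set.forall_mem_range, funext_iff, ← hn]; rfl
    have h2 : (fun j ↦ ∏ i, z i ^ e j i) = 1 ↔ ∀ v ∈ Set.range e, ∏ i, z i ^ v i = 1 := by
      simp only [Set.forall_mem_range, funext_iff]; rfl
    rw [MonoidHom.mem_ker, MonoidHom.mem_ker, h1, ← key z, MonoidHom.mk'_apply, h2, ← key z, hspan]

/-! ### Torus subgroups -/

theorem Pi.exists_pow_prime_pow_eq_one {ι M : Type*} [Fintype ι] [Monoid M] {p : ℕ} {w : ι → M}
    (hw : ∀ i, ∃ k : ℕ, w i ^ p ^ k = 1) : ∃ k : ℕ, w ^ p ^ k = 1 := by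
  choose k hk using hw
  refine ⟨∑ i, k i, funext fun i ↦ ?_⟩
  obtain ⟨c, hc⟩ := pow_dvd_pow p
    (Finset.single_le_sum (f := k) (fun _ _ ↦ Nat.zero_le _) (Finset.mem_univ i))
  rw [Pi.pow_apply, hc, pow_mul, hk, one_pow, Pi.one_apply]

section Torus

variable {G : Type*} [Group G] [TopologicalSpace G]

/-- A subgroup is a torus if, with the subspace topology, it is isomorphic to `(S¹)^r` for
some `r` as a topological group. -/
def IsTorus (T : Subgroup G) : Prop :=
  ∃ r : ℕ, Nonempty (T ≃ₜ* (Fin r → Circle))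

theorem isTorus_bot : IsTorus (⊥ : Subgroup G) :=
  ⟨0, ⟨ContinuousMulEquiv.ofUnique⟩⟩

/-- A homomorphic image of a torus inside a torus is a torus: both the image and a torus with the
same kernel are the quotient of the source by that kernel. -/
theorem isTorus_range [T2Space G] {ι : Type*} [Fintype ι] (f : (ι → Circle) →* G)
    (hf : Continuous f) {T : Subgroup G} (hT : IsTorus T) (hfT : f.range ≤ T) :
    IsTorus f.range := by
  obtain ⟨s, ⟨e⟩⟩ := hT
  let g : (ι → Circle) →* T := f.codRestrict T fun z ↦ hfT ⟨z, rfl⟩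
  have hg : Continuous g := hf.subtype_mk _
  obtain ⟨r, φ, hφ, hφs, hker⟩ := exists_surjective_ker_eq
    ((e : T →* (Fin s → Circle)).comp g) (e.continuous.comp hg)
  have hkerf : φ.ker = f.ker := by
    rw [hker]
    ext z
    simp only [MonoidHom.mem_ker, MonoidHom.comp_apply, g]
    exact (map_eq_one_iff e e.injective).trans (by simp [Subtype.ext_iff])
  let ψ : (Fin r → Circle) ≃* f.range :=
    (QuotientGroup.quotientKerEquivOfSurjective φ hφs).symm.trans
      ((QuotientGroup.quotientMulEquivOfEq hkerf).trans (QuotientGroup.quotientKerEquivRange f))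
  have hψ (z) : ψ (φ z) = f.rangeRestrict z := by
    have : (QuotientGroup.quotientKerEquivOfSurjective φ hφs).symm (φ z) = (z : _ ⧸ φ.ker) := by
      rw [MulEquiv.symm_apply_eq]; rfl
    simp only [ψ, MulEquiv.trans_apply, this]
    rfl
  have hψc : Continuous ψ := by
    rw [(hφ.isClosedMap.isQuotientMap hφ hφs).continuous_iff]
    have : ψ ∘ φ = f.rangeRestrict := funext hψ
    rw [this]
    exact hf.subtype_mk _
  let h : (Fin r → Circle) ≃ₜ f.range := hψc.homeoOfEquivCompactToT2 (f := ψ.toEquiv)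
  exact ⟨r, ⟨ContinuousMulEquiv.symm
    { ψ with continuous_toFun := h.continuous, continuous_invFun := h.symm.continuous }⟩⟩

namespace IsTorus

variable {T : Subgroup G}

theorem mul_comm (hT : IsTorus T) {x y : G} (hx : x ∈ T) (hy : y ∈ T) : x * y = y * x := by
  obtain ⟨r, ⟨e⟩⟩ := hT
  have : (⟨x, hx⟩ * ⟨y, hy⟩ : T) = ⟨y, hy⟩ * ⟨x, hx⟩ :=
    e.injective (by rw [map_mul, map_mul, _root_.mul_comm])
  exact congrArg Subtype.val this

theorem isMulCommutative (hT : IsTorus T) : IsMulCommutative T :=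
  ⟨⟨fun x y ↦ Subtype.ext (hT.mul_comm x.2 y.2)⟩⟩

theorem exists_pow_eq (hT : IsTorus T) {n : ℕ} (hn : n ≠ 0) {x : G} (hx : x ∈ T) :
    ∃ y ∈ T, y ^ n = x := by
  obtain ⟨r, ⟨e⟩⟩ := hT
  choose w hw using fun i ↦ Circle.exists_pow_eq (e ⟨x, hx⟩ i) hn
  refine ⟨e.symm w, (e.symm w).2, ?_⟩
  have : (e.symm w) ^ n = ⟨x, hx⟩ := by
    rw [← map_pow, ContinuousMulEquiv.symm_apply_eq]
    exact funext hw
  exact congrArg Subtype.val this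

theorem finite_setOf_pow_eq_one (hT : IsTorus T) {n : ℕ} (hn : n ≠ 0) :
    {x | x ∈ T ∧ x ^ n = 1}.Finite := by
  obtain ⟨r, ⟨e⟩⟩ := hT
  refine ((Set.Finite.pi' fun _ : Fin r ↦ Circle.finite_setOf_pow_eq_one hn).image
    fun w ↦ (e.symm w : G)).subset ?_
  rintro x ⟨hx, hxn⟩
  refine ⟨e ⟨x, hx⟩, fun i ↦ ?_, by simp⟩
  have : (⟨x, hx⟩ : T) ^ n = 1 := Subtype.ext hxn
  have h2 : e ⟨x, hx⟩ ^ n = 1 := by rw [← map_pow, this, map_one]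
  exact congrFun h2 i

theorem isCompact (hT : IsTorus T) : IsCompact (T : Set G) := by
  obtain ⟨r, ⟨e⟩⟩ := hT
  have : CompactSpace T := e.symm.toHomeomorph.compactSpace
  exact isCompact_iff_compactSpace.2 this

theorem subset_closure_torsion (hT : IsTorus T) {p : ℕ} (hp : 1 < p) :
    (T : Set G) ⊆ closure {x | x ∈ T ∧ ∃ k : ℕ, x ^ p ^ k = 1} := by
  obtain ⟨r, ⟨e⟩⟩ := hT
  have hd : Dense {w : Fin r → Circle | ∀ i, ∃ k : ℕ, w i ^ p ^ k = 1} := by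
    have := dense_pi (Set.univ : Set (Fin r))
      (s := fun _ ↦ {z : Circle | ∃ k : ℕ, z ^ p ^ k = 1})
      fun i _ ↦ Circle.dense_setOf_exists_pow_eq_one hp
    refine this.mono ?_
    exact fun w hw i ↦ hw i (Set.mem_univ i)
  intro x hx
  have hc : Continuous fun w ↦ (e.symm w : G) := continuous_subtype_val.comp e.symm.continuous
  have h1 := image_closure_subset_closure_image hc (s := {w | ∀ i, ∃ k : ℕ, w i ^ p ^ k = 1})
    ⟨e ⟨x, hx⟩, hd _, rfl⟩
  simp only [ContinuousMulEquiv.symm_apply_apply] at h1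
  refine closure_mono ?_ h1
  rintro _ ⟨w, hw, rfl⟩
  refine ⟨(e.symm w).2, ?_⟩
  obtain ⟨k, hk⟩ := Pi.exists_pow_prime_pow_eq_one hw
  have h2 : (e.symm w) ^ p ^ k = 1 := by rw [← map_pow, hk, map_one]
  exact ⟨k, congrArg Subtype.val h2⟩

/-- If `A` is a `p`-torsion group containing the `p`-power torsion of a torus `T`, then `A ∩ T` is
a discrete `p`-torus. -/
theorem exists_mulEquiv_prufer (hT : IsTorus T) {p : ℕ} [Fact p.Prime] {A : Subgroup G}
    (hA : ∀ a ∈ A, ∃ k : ℕ, a ^ p ^ k = 1)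
    (hTA : ∀ t ∈ T, ∀ k : ℕ, t ^ p ^ k = 1 → t ∈ A) :
    ∃ r : ℕ, Nonempty (T.subgroupOf A ≃* (Fin r → PruferGroup p)) := by
  obtain ⟨r, ⟨e⟩⟩ := hT
  let j : T.subgroupOf A →* T :=
    MonoidHom.mk' (fun x ↦ ⟨x.1.1, x.2⟩) fun _ _ ↦ rfl
  have htor (x : T.subgroupOf A) (i) : e (j x) i ∈ CommGroup.primaryComponent Circle p := by
    obtain ⟨k, hk⟩ := hA _ x.1.2
    refine ⟨k, ?_⟩
    have h1 : j x ^ p ^ k = 1 := Subtype.ext hk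
    have h2 : e (j x) ^ p ^ k = 1 := by rw [← map_pow, h1, map_one]
    exact congrFun h2 i
  let Φ : T.subgroupOf A →* (Fin r → PruferGroup p) :=
    MonoidHom.mk' (fun x i ↦ ⟨e (j x) i, htor x i⟩) fun x y ↦ by
      funext i
      apply Subtype.ext
      simp
  refine ⟨r, ⟨MulEquiv.ofBijective Φ ⟨fun x y hxy ↦ ?_, fun w ↦ ?_⟩⟩⟩
  · have : e (j x) = e (j y) := funext fun i ↦ congrArg Subtype.val (congrFun hxy i)
    have hj : j x = j y := e.injective this
    exact Subtype.ext (Subtype.ext (show (j x : G) = j y by rw [hj]))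
  · let u := e.symm fun i ↦ (w i : Circle)
    obtain ⟨k, hk⟩ := Pi.exists_pow_prime_pow_eq_one fun i ↦ (w i).2
    have hu : u ^ p ^ k = 1 := by rw [← map_pow, hk, map_one]
    refine ⟨⟨⟨u, hTA _ u.2 k (congrArg Subtype.val hu)⟩, u.2⟩, ?_⟩
    funext i
    apply Subtype.ext
    change e u i = w i
    simp [u]

end IsTorus

end Torus

/-! ### `p`-toral extensions and discretizations -/

section PToral

variable {G : Type*} [Group G]

theorem Subgroup.mem_sup_iff_exists_mul {A S : Subgroup G}
    (h : ∀ a ∈ A, ∀ s ∈ S, a * s * a⁻¹ ∈ S) {x : G} :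
    x ∈ A ⊔ S ↔ ∃ a ∈ A, ∃ s ∈ S, a * s = x := by
  have hle : A ≤ Subgroup.normalizer (S : Set G) := fun a ha ↦ by
    rw [Subgroup.mem_normalizer_iff]
    refine fun s ↦ ⟨h a ha s, fun hs ↦ ?_⟩
    have := h a⁻¹ (inv_mem ha) _ hs
    simpa [mul_assoc] using this
  rw [← SetLike.mem_coe, Subgroup.coe_mul_of_left_le_normalizer_right A S hle, Set.mem_mul]
  rfl

theorem Subgroup.exists_mul_pow_eq {A S : Subgroup G} (h : ∀ a ∈ A, ∀ s ∈ S, a * s * a⁻¹ ∈ S)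
    {a s : G} (ha : a ∈ A) (hs : s ∈ S) (m : ℕ) : ∃ s' ∈ S, (a * s) ^ m = a ^ m * s' := by
  induction m with
  | zero => exact ⟨1, one_mem S, by simp⟩
  | succ m ih =>
    obtain ⟨s', hs', e⟩ := ih
    refine ⟨a⁻¹ * s' * a * s, mul_mem (by simpa using h a⁻¹ (inv_mem ha) s' hs') hs, ?_⟩
    rw [pow_succ, e, pow_succ]
    group

theorem IsDiscretePToral.exists_pow_eq_one {p : ℕ} {P : Subgroup G} (hP : IsDiscretePToral p P)
    {x : G} (hx : x ∈ P) : ∃ k : ℕ, x ^ p ^ k = 1 := by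
  obtain ⟨r, T, hT, ⟨e⟩, -, hquot⟩ := hP
  obtain ⟨n, hn⟩ := isPGroup_iff_pow_pow_eq_one.1 hquot ((⟨x, hx⟩ : P) : P ⧸ T)
  have hmem : (⟨x, hx⟩ : P) ^ p ^ n ∈ T := by
    rwa [← QuotientGroup.mk_pow, QuotientGroup.eq_one_iff] at hn
  obtain ⟨k, hk⟩ := Pi.exists_pow_prime_pow_eq_one (p := p) (w := e ⟨_, hmem⟩) fun i ↦ by
    obtain ⟨k, hk⟩ := (e ⟨_, hmem⟩ i).2
    exact ⟨k, Subtype.ext hk⟩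
  have h1 : (⟨_, hmem⟩ : T) ^ p ^ k = 1 := e.injective (by rw [map_pow, hk, map_one])
  refine ⟨n + k, ?_⟩
  have h2 : ((x ^ p ^ n) ^ p ^ k : G) = 1 := congrArg (fun t : T ↦ ((t : P) : G)) h1
  rw [pow_add, pow_mul, h2]

variable [TopologicalSpace G]

/-- `K` is an extension of the torus `T` by a finite `p`-group. This records the torus in the
ambient group; the quotient is described by its finite order and its exponent. -/
structure IsPToralExtension (p : ℕ) (T K : Subgroup G) : Prop where
  le : T ≤ K
  isTorus : IsTorus T
  conj_mem : ∀ k ∈ K, ∀ t ∈ T, k * t * k⁻¹ ∈ T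
  relIndex_ne_zero : T.relIndex K ≠ 0
  exists_pow_mem : ∃ n : ℕ, ∀ k ∈ K, k ^ p ^ n ∈ T

theorem isPToral_iff_exists_isPToralExtension {p : ℕ} {K : Subgroup G} :
    IsPToral p K ↔ ∃ T, IsPToralExtension p T K := by
  constructor
  · rintro ⟨r, T, hT, ⟨e⟩, hfin, hquot⟩
    refine ⟨T.map K.subtype, Subgroup.map_subtype_le T, ⟨r, ⟨?_⟩⟩, ?_, ?_, ?_⟩
    · let i := T.equivMapOfInjective K.subtype K.subtype_injective
      have hi : Continuous i := by
        refine Continuous.subtype_mk ?_ _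
        exact continuous_subtype_val.comp continuous_subtype_val
      have hi' : Continuous i.symm := by
        refine Topology.IsInducing.subtypeVal.continuous_iff.2
          (Topology.IsInducing.subtypeVal.continuous_iff.2 ?_)
        convert! continuous_subtype_val using 1
        funext x
        obtain ⟨y, rfl⟩ := i.surjective x
        simp only [Function.comp_apply, MulEquiv.symm_apply_apply]
        rfl
      exact ContinuousMulEquiv.trans
        { i.symm with continuous_toFun := hi', continuous_invFun := hi } e
    · rintro k hk _ ⟨t, ht, rfl⟩
      exact ⟨_, hT.conj_mem t ht ⟨k, hk⟩, rfl⟩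
    · rw [Subgroup.relIndex, Subgroup.subgroupOf,
        Subgroup.comap_map_eq_self_of_injective K.subtype_injective]
      exact Subgroup.finiteIndex_iff.1 (Subgroup.finiteIndex_iff_finite_quotient.2 hfin)
    · obtain ⟨n, hn⟩ := hquot.exists_card_dvd_pow
      refine ⟨n, fun k hk ↦ ⟨⟨k, hk⟩ ^ p ^ n, ?_, rfl⟩⟩
      rw [SetLike.mem_coe, ← QuotientGroup.eq_one_iff, QuotientGroup.mk_pow]
      obtain ⟨c, hc⟩ := hn
      rw [hc, pow_mul, pow_card_eq_one', one_pow]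
  · rintro ⟨T, hle, ⟨r, ⟨e⟩⟩, hconj, hidx, n, hn⟩
    have hnorm : (T.subgroupOf K).Normal := ⟨fun t ht k ↦ hconj k k.2 t ht⟩
    refine ⟨r, T.subgroupOf K, hnorm, ⟨?_⟩, ?_, ?_⟩
    · exact ContinuousMulEquiv.trans { Subgroup.subgroupOfEquivOfLe hle with
        continuous_toFun := by
          exact Continuous.subtype_mk (continuous_subtype_val.comp continuous_subtype_val) _
        continuous_invFun := by
          exact (continuous_subtype_val.subtype_mk _).subtype_mk _ } e
    · exact Subgroup.finiteIndex_iff_finite_quotient.1 (Subgroup.finiteIndex_iff.2 hidx)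
    · refine isPGroup_iff_pow_pow_eq_one.2 fun x ↦ ⟨n, ?_⟩
      obtain ⟨k, rfl⟩ := QuotientGroup.mk_surjective x
      rw [← QuotientGroup.mk_pow, QuotientGroup.eq_one_iff]
      exact hn k k.2

namespace IsPToralExtension

variable {p : ℕ} {T K : Subgroup G}

theorem isPToral (h : IsPToralExtension p T K) : IsPToral p K :=
  isPToral_iff_exists_isPToralExtension.2 ⟨T, h⟩

theorem isClosed [IsTopologicalGroup G] [T2Space G] (h : IsPToralExtension p T K) :
    IsClosed (K : Set G) := by
  have : Finite (K ⧸ T.subgroupOf K) :=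
    Subgroup.finiteIndex_iff_finite_quotient.1 (Subgroup.finiteIndex_iff.2 h.relIndex_ne_zero)
  have hK : (K : Set G) = ⋃ q : K ⧸ T.subgroupOf K, (fun t ↦ (q.out : G) * t) '' T := by
    ext k
    simp only [SetLike.mem_coe, Set.mem_iUnion, Set.mem_image]
    constructor
    · intro hk
      refine ⟨((⟨k, hk⟩ : K) : K ⧸ T.subgroupOf K), _, ?_, mul_inv_cancel_left _ _⟩
      have hmem := QuotientGroup.eq.1
        (QuotientGroup.out_eq' ((⟨k, hk⟩ : K) : K ⧸ T.subgroupOf K))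
      exact hmem
    · rintro ⟨q, t, ht, rfl⟩
      exact mul_mem q.out.2 (h.le ht)
  rw [hK]
  exact isClosed_iUnion_of_finite fun q ↦
    (h.isTorus.isCompact.image (continuous_const_mul _)).isClosed

/-- A dense subgroup of `K` meets every coset of the torus, as the torus is open in `K`. -/
theorem exists_mul_of_closure_eq [IsTopologicalGroup G] [T2Space G] (h : IsPToralExtension p T K)
    {P : Subgroup G} (hP : closure (P : Set G) = K) {k : G} (hk : k ∈ K) :
    ∃ x ∈ P, ∃ t ∈ T, k = x * t := by
  have : (T.subgroupOf K).FiniteIndex := Subgroup.finiteIndex_iff.2 h.relIndex_ne_zero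
  have hcl : IsClosed ((T.subgroupOf K : Subgroup K) : Set K) :=
    h.isTorus.isCompact.isClosed.preimage continuous_subtype_val
  obtain ⟨U, hU, hUT⟩ := isOpen_induced_iff.1
    ((T.subgroupOf K).isOpen_of_isClosed_of_finiteIndex hcl)
  have hPK : (P : Set G) ⊆ K := hP ▸ subset_closure
  have hUmem (y : K) : (y : G) ∈ U ↔ (y : G) ∈ T :=
    iff_of_eq (congrArg (fun s : Set K ↦ y ∈ s) hUT)
  have h1 : (1 : G) ∈ U := (hUmem 1).2 (one_mem T)
  have hk' : k ∈ closure (P : Set G) := hP ▸ hk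
  obtain ⟨x, hxU, hxP⟩ := mem_closure_iff.1 hk' ((fun y ↦ k⁻¹ * y) ⁻¹' U)
    (hU.preimage (continuous_const_mul _)) (by simpa using h1)
  have hxT : k⁻¹ * x ∈ T := (hUmem ⟨k⁻¹ * x, mul_mem (inv_mem hk) (hPK hxP)⟩).1 hxU
  exact ⟨x, hxP, _, inv_mem hxT, by group⟩

theorem isDiscretePToral_of_le [Fact p.Prime] (h : IsPToralExtension p T K) {A : Subgroup G}
    (hAK : A ≤ K) (hA : ∀ a ∈ A, ∃ k : ℕ, a ^ p ^ k = 1)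
    (hTA : ∀ t ∈ T, ∀ k : ℕ, t ^ p ^ k = 1 → t ∈ A) : IsDiscretePToral p A := by
  obtain ⟨r, hr⟩ := h.isTorus.exists_mulEquiv_prufer hA hTA
  have hnorm : (T.subgroupOf A).Normal := ⟨fun t ht a ↦ h.conj_mem a (hAK a.2) t ht⟩
  refine ⟨r, T.subgroupOf A, hnorm, hr, ?_, ?_⟩
  · refine Subgroup.finiteIndex_iff_finite_quotient.1 (Subgroup.finiteIndex_iff.2 ?_)
    exact fun h0 ↦ h.relIndex_ne_zero (Subgroup.relIndex_eq_zero_of_le_right hAK h0)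
  · obtain ⟨n, hn⟩ := h.exists_pow_mem
    refine isPGroup_iff_pow_pow_eq_one.2 fun x ↦ ⟨n, ?_⟩
    obtain ⟨a, rfl⟩ := QuotientGroup.mk_surjective x
    rw [← QuotientGroup.mk_pow, QuotientGroup.eq_one_iff]
    exact hn a (hAK a.2)

/-- Criterion for `A` to be a `p`-discretization of an extension `K` of `T`: `A` is `p`-torsion,
contains all `p`-power torsion of `T`, and meets every coset of `T`. -/
theorem isPDiscretization [Fact p.Prime] [IsTopologicalGroup G] [T2Space G]
    (h : IsPToralExtension p T K) {A : Subgroup G}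
    (hAK : A ≤ K) (hA : ∀ a ∈ A, ∃ k : ℕ, a ^ p ^ k = 1)
    (hTA : ∀ t ∈ T, ∀ k : ℕ, t ^ p ^ k = 1 → t ∈ A)
    (hmul : ∀ k ∈ K, ∃ a ∈ A, ∃ t ∈ T, k = a * t) : IsPDiscretization p A K := by
  have hdisc := h.isDiscretePToral_of_le hAK hA hTA
  have hTcl : (T : Set G) ⊆ closure (A : Set G) :=
    (h.isTorus.subset_closure_torsion (Fact.out : p.Prime).one_lt).trans
      (closure_mono fun t ⟨ht, k, hk⟩ ↦ hTA t ht k hk)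
  have hcl : closure (A : Set G) = K := by
    refine (closure_minimal hAK h.isClosed).antisymm fun k hk ↦ ?_
    obtain ⟨a, ha, t, ht, rfl⟩ := hmul k hk
    exact mul_mem (s := A.topologicalClosure) (subset_closure ha) (hTcl ht)
  refine ⟨h.isPToral, hdisc, ⟨⟨hdisc, subset_closure⟩, fun M ⟨hM, hMA⟩ hAM m hm ↦ ?_⟩, hcl⟩
  rw [hcl] at hMA
  obtain ⟨a, ha, t, ht, rfl⟩ := hmul m (hMA hm)
  have htM : t ∈ M := by simpa using mul_mem (inv_mem (hAM ha)) hm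
  obtain ⟨k, hk⟩ := hM.exists_pow_eq_one htM
  exact mul_mem ha (hTA t ht k hk)

/-- The `p`-power torsion of a torus is contained in any snugly embedded dense subgroup, since it
can be adjoined without leaving the class of discrete `p`-toral groups. -/
theorem mem_of_pow_eq_one [Fact p.Prime] (h : IsPToralExtension p T K) {P : Subgroup G}
    (hP : IsPDiscretization p P K) {t : G} (ht : t ∈ T) {k : ℕ} (hk : t ^ p ^ k = 1) : t ∈ P := by
  have hPK : P ≤ K := fun x hx ↦ by
    rw [← SetLike.mem_coe, ← hP.closure_eq]
    exact subset_closure hx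
  let S : Subgroup G :=
    { carrier := {x | x ∈ T ∧ ∃ k : ℕ, x ^ p ^ k = 1}
      one_mem' := ⟨one_mem T, 0, one_pow _⟩
      mul_mem' := by
        rintro a b ⟨ha, m, hm⟩ ⟨hb, n, hn⟩
        refine ⟨mul_mem ha hb, m + n, ?_⟩
        have hab : Commute a b := h.isTorus.mul_comm ha hb
        rw [hab.mul_pow, pow_add, pow_mul, hm, mul_comm (p ^ m), pow_mul, hn]
        simp
      inv_mem' := by
        rintro a ⟨ha, m, hm⟩
        exact ⟨inv_mem ha, m, by rw [inv_pow, hm, inv_one]⟩ }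
  have hconj : ∀ a ∈ P, ∀ s ∈ S, a * s * a⁻¹ ∈ S := by
    rintro a ha s ⟨hs, m, hm⟩
    exact ⟨h.conj_mem a (hPK ha) s hs, m, by rw [conj_pow, hm]; simp⟩
  have hSK : S ≤ K := fun s hs ↦ h.le hs.1
  have hM : IsDiscretePToral p (P ⊔ S) := by
    refine h.isDiscretePToral_of_le (sup_le hPK hSK) (fun x hx ↦ ?_) fun t ht k hk ↦
      (le_sup_right : S ≤ P ⊔ S) ⟨ht, k, hk⟩
    obtain ⟨a, ha, s, hs, rfl⟩ := (Subgroup.mem_sup_iff_exists_mul hconj).1 hx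
    obtain ⟨m, hm⟩ := hP.isDiscretePToral.exists_pow_eq_one ha
    obtain ⟨s', ⟨-, n, hn⟩, e⟩ := Subgroup.exists_mul_pow_eq hconj ha hs (p ^ m)
    exact ⟨m + n, by rw [pow_add, pow_mul, e, hm, one_mul, hn]⟩
  have hcl : ((P ⊔ S : Subgroup G) : Set G) ⊆ closure (P : Set G) := by
    rw [hP.closure_eq]
    exact sup_le hPK hSK
  exact hP.isSnuglyEmbedded.2 ⟨hM, hcl⟩ le_sup_left (le_sup_right (a := P) (b := S) ⟨ht, k, hk⟩)

end IsPToralExtension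

namespace IsPDiscretization

variable {p : ℕ} {P K : Subgroup G}

theorem le (h : IsPDiscretization p P K) : P ≤ K := fun x hx ↦ by
  rw [← SetLike.mem_coe, ← h.closure_eq]
  exact subset_closure hx

/-- By snugness, `Q` is the whole intersection of its closure with a larger `p`-torsion group. -/
theorem inf_eq [Fact p.Prime] {Q L : Subgroup G} (hQ : IsPDiscretization p Q L)
    (hP : IsPDiscretization p P K) (hQP : Q ≤ P) : P ⊓ L = Q := by
  obtain ⟨T, hT⟩ := isPToral_iff_exists_isPToralExtension.1 hQ.isPToral
  refine le_antisymm (hQ.isSnuglyEmbedded.2 ⟨?_, ?_⟩ (le_inf hQP hQ.le)) (le_inf hQP hQ.le)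
  · exact hT.isDiscretePToral_of_le inf_le_right
      (fun a ha ↦ hP.isDiscretePToral.exists_pow_eq_one ha.1)
      fun t ht k hk ↦ ⟨hQP (hT.mem_of_pow_eq_one hQ ht hk), hT.le ht⟩
  · rw [hQ.closure_eq]
    exact (inf_le_right : P ⊓ L ≤ L)

end IsPDiscretization

end PToral

/-! ### The norm map -/

section Norm

variable {G : Type*} [Group G] [TopologicalSpace G]

theorem IsTorus.map_range_sup [IsTopologicalGroup G] [T2Space G] {T D : Subgroup G}
    (hT : IsTorus T) (hD : IsTorus D) (hDT : D ≤ T) (N : T →* T) (hN : Continuous N) :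
    IsTorus (N.range.map T.subtype ⊔ D) := by
  obtain ⟨r, ⟨e⟩⟩ := id hT
  obtain ⟨s, ⟨e'⟩⟩ := id hD
  let f : (Fin r ⊕ Fin s → Circle) →* G :=
    MonoidHom.mk' (fun z ↦ (N (e.symm (z ∘ Sum.inl)) : G) * (e'.symm (z ∘ Sum.inr) : G))
      fun z w ↦ by
        have hz : (z * w) ∘ Sum.inl =
          (z ∘ Sum.inl) * (w ∘ (Sum.inl : Fin r → Fin r ⊕ Fin s)) := rfl
        have hw : (z * w) ∘ Sum.inr =
          (z ∘ Sum.inr) * (w ∘ (Sum.inr : Fin s → Fin r ⊕ Fin s)) := rfl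
        have hc : Commute (N (e.symm (w ∘ Sum.inl)) : G) (e'.symm (z ∘ Sum.inr) : G) :=
          hT.mul_comm (N (e.symm (w ∘ Sum.inl))).2 (hDT (e'.symm (z ∘ Sum.inr)).2)
        rw [hz, hw, map_mul, map_mul, map_mul, Subgroup.coe_mul, Subgroup.coe_mul]
        exact hc.mul_mul_mul_comm _ _
  have hf : Continuous f := by
    refine Continuous.mul ?_ ?_
    · exact continuous_subtype_val.comp (hN.comp (e.symm.continuous.comp
        (continuous_pi fun i ↦ continuous_apply _)))
    · exact continuous_subtype_val.comp (e'.symm.continuous.comp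
        (continuous_pi fun i ↦ continuous_apply _))
  have hrange : f.range = N.range.map T.subtype ⊔ D := by
    ext x
    rw [Subgroup.mem_sup_iff_exists_mul]
    · constructor
      · rintro ⟨z, rfl⟩
        exact ⟨_, ⟨_, ⟨_, rfl⟩, rfl⟩, _, (e'.symm (z ∘ Sum.inr)).2, rfl⟩
      · rintro ⟨_, ⟨_, ⟨t, rfl⟩, rfl⟩, d, hd, rfl⟩
        refine ⟨Sum.elim (e t) (e' ⟨d, hd⟩), ?_⟩
        simp [f]
    · rintro _ ⟨t, -, rfl⟩ d hd
      have : (t : G) * d = d * t := hT.mul_comm t.2 (hDT hd)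
      simpa [this] using hd
  rw [← hrange]
  refine isTorus_range f hf hT ?_
  rw [hrange]
  exact sup_le (Subgroup.map_subtype_le _) hDT

open scoped IsMulCommutative in
/-- If `Q` acts on a torus `T` by conjugation through a finite `p`-group `F` of order `p ^ k`, the
product over `F` is a norm map `N`: it takes values in the fixed points of `Q`, and it differs
from the `p ^ k`-th power map by a product of commutators. -/
theorem IsTorus.exists_norm [IsTopologicalGroup G] {p : ℕ} [Fact p.Prime] {T Q : Subgroup G}
    (hT : IsTorus T) (hconj : ∀ q ∈ Q, ∀ t ∈ T, q * t * q⁻¹ ∈ T) (hidx : T.relIndex Q ≠ 0)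
    (hpow : ∃ n : ℕ, ∀ q ∈ Q, q ^ p ^ n ∈ T) :
    ∃ (k : ℕ) (N : T →* T), Continuous N ∧ (∀ q ∈ Q, ∀ t, q * (N t : G) * q⁻¹ = N t) ∧
      ∀ (D : Subgroup G) (t : T), (∀ q ∈ Q, q * t * q⁻¹ * (t : G)⁻¹ ∈ D) →
        (N t : G) * ((t : G) ^ p ^ k)⁻¹ ∈ D := by
  have := hT.isMulCommutative
  have hle : Q ≤ Subgroup.normalizer (T : Set G) := fun a ha ↦ by
    rw [Subgroup.mem_normalizer_iff]
    refine fun s ↦ ⟨hconj a ha s, fun hs ↦ ?_⟩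
    have := hconj a⁻¹ (inv_mem ha) _ hs
    simpa [mul_assoc] using this
  let ρ : Q →* MulAut T := T.normalizerMonoidHom.comp (Subgroup.inclusion hle)
  have hρ (q : Q) (t : T) : (ρ q t : G) = q * t * (q : G)⁻¹ := rfl
  have hker : T.subgroupOf Q ≤ ρ.ker := fun q hq ↦ by
    rw [MonoidHom.mem_ker]
    ext t
    rw [hρ, hT.mul_comm (Subgroup.mem_subgroupOf.1 hq) t.2]
    simp
  have hfinker : ρ.ker.FiniteIndex := by
    have : (T.subgroupOf Q).FiniteIndex := Subgroup.finiteIndex_iff.2 hidx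
    exact Subgroup.finiteIndex_of_le hker
  have hfin : Finite ρ.range := Finite.of_equiv _ (QuotientGroup.quotientKerEquivRange ρ).toEquiv
  have hpG : IsPGroup p ρ.range := by
    obtain ⟨n, hn⟩ := hpow
    refine isPGroup_iff_pow_pow_eq_one.2 ?_
    rintro ⟨_, q, rfl⟩
    refine ⟨n, Subtype.ext ?_⟩
    have : q ^ p ^ n ∈ ρ.ker := hker (hn q q.2)
    rwa [MonoidHom.mem_ker, map_pow] at this
  obtain ⟨k, hk⟩ := IsPGroup.iff_card.1 hpG
  have : Fintype ρ.range := Fintype.ofFinite _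
  have hcont (σ : ρ.range) : Continuous (σ : MulAut T) := by
    obtain ⟨_, q, rfl⟩ := σ
    refine Topology.IsInducing.subtypeVal.continuous_iff.2 ?_
    change Continuous fun t : T ↦ (q : G) * t * (q : G)⁻¹
    fun_prop
  let N : T →* T := ∏ σ : ρ.range, ((σ : MulAut T) : T →* T)
  have hN (t : T) : N t = ∏ σ : ρ.range, (σ : MulAut T) t := by
    simp [N, MonoidHom.finsetProd_apply]
  refine ⟨k, N, ?_, fun q hq t ↦ ?_, fun D t h ↦ ?_⟩
  · have : (N : T → T) = fun t ↦ ∏ σ : ρ.range, (σ : MulAut T) t := funext hN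
    rw [this]
    exact continuous_finsetProd _ fun σ _ ↦ hcont σ
  · rw [← hρ ⟨q, hq⟩, hN, map_prod]
    congr 1
    exact Fintype.prod_equiv (Equiv.mulLeft (⟨ρ ⟨q, hq⟩, ⟨_, rfl⟩⟩ : ρ.range)) _ _ fun σ ↦ rfl
  · have hprod : N t * (t ^ p ^ k)⁻¹ = ∏ σ : ρ.range, (σ : MulAut T) t * t⁻¹ := by
      rw [Finset.prod_mul_distrib, hN, Finset.prod_const, Finset.card_univ,
        ← Nat.card_eq_fintype_card, hk, inv_pow]
    have hmem : N t * (t ^ p ^ k)⁻¹ ∈ D.subgroupOf T := by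
      rw [hprod]
      refine prod_mem ?_
      rintro ⟨_, q, rfl⟩ -
      exact h q q.2
    exact hmem

end Norm

/-! ### Subgroups containing the fixed points of the action -/

section Subgroups

variable {G : Type*} [Group G] [TopologicalSpace G] [IsTopologicalGroup G] [T2Space G]

/-- A sufficient condition for `P ⊓ K` to be a `p`-discretization of a subgroup `K` of a `p`-toral
group `L`. Here `D` is a torus in `K`, and the hypotheses say that modulo `D` the torus elements
of `K` are, up to `p`-power exponent, fixed by `Q`. The torus of `K` is `N(T) D`, where `N` is the
norm map of `Q`. If `x * t ∈ K` with `x ∈ P` and `t ∈ T`, then `t` differs from the norm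
of a `p`-power root of `t` by an element of `(P ⊓ T) D`. -/
theorem IsPToralExtension.isPDiscretization_inf {p : ℕ} [Fact p.Prime] {T L P Q D K : Subgroup G}
    (hT : IsPToralExtension p T L) (hP : IsPDiscretization p P L) (hQP : Q ≤ P)
    (hD : IsTorus D) (hDT : D ≤ T) (hKL : K ≤ L) (hDK : D ≤ K)
    (hfix : ∀ t ∈ T, (∀ q ∈ Q, q * t * q⁻¹ = t) → t ∈ K)
    (hexp : ∃ a : ℕ, ∀ x ∈ K, x ∈ T → ∀ q ∈ Q, (q * x * q⁻¹ * x⁻¹) ^ p ^ a ∈ D)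
    (hcomm : ∀ x ∈ P, ∀ t ∈ T, x * t ∈ K → ∀ q ∈ Q, ∃ s ∈ P, ∃ d ∈ D,
      q * t * q⁻¹ * t⁻¹ = s * d) :
    IsPDiscretization p (P ⊓ K) K := by
  have hp0 (n : ℕ) : p ^ n ≠ 0 := pow_ne_zero _ (Fact.out : p.Prime).ne_zero
  have hQL : Q ≤ L := hQP.trans hP.le
  obtain ⟨n, hn⟩ := hT.exists_pow_mem
  obtain ⟨a, ha⟩ := hexp
  obtain ⟨k, N, hNc, hNfix, hNpow⟩ := hT.isTorus.exists_norm (p := p)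
    (fun q hq ↦ hT.conj_mem q (hQL hq))
    (fun h0 ↦ hT.relIndex_ne_zero (Subgroup.relIndex_eq_zero_of_le_right hQL h0))
    ⟨n, fun q hq ↦ hn q (hQL hq)⟩
  have hbr {q t : G} (hq : q ∈ Q) (ht : t ∈ T) : q * t * q⁻¹ * t⁻¹ ∈ T :=
    mul_mem (hT.conj_mem q (hQL hq) t ht) (inv_mem ht)
  have hbrpow {q t : G} (hq : q ∈ Q) (ht : t ∈ T) (m : ℕ) :
      q * t ^ m * q⁻¹ * (t ^ m)⁻¹ = (q * t * q⁻¹ * t⁻¹) ^ m := by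
    have hc : Commute (q * t * q⁻¹) t⁻¹ :=
      hT.isTorus.mul_comm (hT.conj_mem q (hQL hq) t ht) (inv_mem ht)
    rw [hc.mul_pow, conj_pow, inv_pow]
  let T₀ : Subgroup G := N.range.map T.subtype ⊔ D
  have hT₀ : IsTorus T₀ := hT.isTorus.map_range_sup hD hDT N hNc
  have hNT₀ (t : T) : (N t : G) ∈ T₀ := (le_sup_left : _ ≤ T₀) ⟨_, ⟨t, rfl⟩, rfl⟩
  have hDT₀ : D ≤ T₀ := le_sup_right
  have hT₀T : T₀ ≤ T := sup_le (Subgroup.map_subtype_le _) hDT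
  have hT₀K : T₀ ≤ K := by
    refine sup_le ?_ hDK
    rintro _ ⟨_, ⟨t, rfl⟩, rfl⟩
    exact hfix _ (N t).2 fun q hq ↦ hNfix q hq t
  -- Modulo `D`, the norm of `x ^ p ^ a` is `x ^ p ^ (a + k)`.
  have hpowT₀ : ∀ x ∈ K, x ∈ T → x ^ p ^ (a + k) ∈ T₀ := fun x hxK hxT ↦ by
    have h1 := hNpow D ⟨x ^ p ^ a, pow_mem hxT _⟩ fun q hq ↦ by
      rw [hbrpow hq hxT]
      exact ha x hxK hxT q hq
    have h2 := mul_mem (inv_mem (hDT₀ h1)) (hNT₀ ⟨x ^ p ^ a, pow_mem hxT _⟩)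
    simpa [pow_add, pow_mul] using h2
  have hE : IsPToralExtension p T₀ K := by
    refine ⟨hT₀K, hT₀, fun g hg t ht ↦ ?_, ?_, n + (a + k), fun g hg ↦ ?_⟩
    · -- `T₀` consists of the `p ^ (a + k)`-th powers in `K ⊓ T`, which is normal in `K`.
      obtain ⟨y, hy, rfl⟩ := hT₀.exists_pow_eq (hp0 (a + k)) ht
      rw [← conj_pow]
      exact hpowT₀ _ (mul_mem (mul_mem hg (hT₀K hy)) (inv_mem hg))
        (hT.conj_mem g (hKL hg) y (hT₀T hy))
    · have hidx : (K ⊓ T).relIndex K ≠ 0 := by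
        rw [inf_comm, Subgroup.inf_relIndex_right]
        exact fun h0 ↦ hT.relIndex_ne_zero (Subgroup.relIndex_eq_zero_of_le_right hKL h0)
      refine Subgroup.relIndex_ne_zero_trans ?_ hidx
      refine Subgroup.finiteIndex_iff.1 (Subgroup.finiteIndex_iff_finite_quotient.2 ?_)
      -- The quotient is represented by the elements of `T` killed by `p ^ (a + k)`.
      have hfin : Finite {x : ↥(K ⊓ T) | (x : G) ^ p ^ (a + k) = 1} :=
        ((hT.isTorus.finite_setOf_pow_eq_one (hp0 (a + k))).preimage
          Subtype.val_injective.injOn).subset fun x hx ↦ ⟨x.2.2, hx⟩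
      refine Finite.of_surjective
        (fun u : {x : ↥(K ⊓ T) | (x : G) ^ p ^ (a + k) = 1} ↦
          ((u : ↥(K ⊓ T)) : ↥(K ⊓ T) ⧸ T₀.subgroupOf (K ⊓ T))) fun c ↦ ?_
      obtain ⟨⟨x, hxK, hxT⟩, rfl⟩ := QuotientGroup.mk_surjective c
      obtain ⟨y, hy, hyx⟩ := hT₀.exists_pow_eq (hp0 (a + k)) (hpowT₀ x hxK hxT)
      have hc : Commute x y⁻¹ := hT.isTorus.mul_comm hxT (inv_mem (hT₀T hy))
      refine ⟨⟨⟨x * y⁻¹, K.mul_mem hxK (K.inv_mem (hT₀K hy)), T.mul_mem hxT (T.inv_mem (hT₀T hy))⟩, ?_⟩,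
        QuotientGroup.eq.2 ?_⟩
      · change (x * y⁻¹) ^ p ^ (a + k) = 1
        rw [hc.mul_pow, inv_pow, hyx, mul_inv_cancel]
      · change (x * y⁻¹)⁻¹ * x ∈ T₀
        simpa using hy
    · rw [pow_add, pow_mul]
      exact hpowT₀ _ (pow_mem hg _) (hn g (hKL hg))
  refine hE.isPDiscretization inf_le_right
    (fun x hx ↦ hP.isDiscretePToral.exists_pow_eq_one hx.1)
    (fun t ht m hm ↦ ⟨hT.mem_of_pow_eq_one hP (hT₀T ht) hm, hT₀K ht⟩) fun g hg ↦ ?_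
  obtain ⟨x, hx, t, ht, rfl⟩ := hT.exists_mul_of_closure_eq hP.closure_eq (hKL hg)
  obtain ⟨y, hy, rfl⟩ := hT.isTorus.exists_pow_eq (hp0 k) ht
  have hconjPD : ∀ s ∈ P ⊓ T, ∀ d ∈ D, s * d * s⁻¹ ∈ D := fun s hs d hd ↦ by
    rw [hT.isTorus.mul_comm hs.2 (hDT hd)]
    simpa using hd
  have hbrmem : ∀ q ∈ Q, q * y * q⁻¹ * y⁻¹ ∈ (P ⊓ T) ⊔ D := fun q hq ↦ by
    obtain ⟨s, hs, d, hd, hsd⟩ := hcomm x hx _ ht hg q hq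
    obtain ⟨d', hd', rfl⟩ := hD.exists_pow_eq (hp0 k) hd
    rw [hbrpow hq hy] at hsd
    have hbT := hbr hq hy
    have hc : Commute (q * y * q⁻¹ * y⁻¹) d'⁻¹ :=
      hT.isTorus.mul_comm hbT (inv_mem (hDT hd'))
    have hu : (q * y * q⁻¹ * y⁻¹ * d'⁻¹) ^ p ^ k = s := by
      rw [hc.mul_pow, hsd, inv_pow, mul_inv_cancel_right]
    have huT : q * y * q⁻¹ * y⁻¹ * d'⁻¹ ∈ T := mul_mem hbT (inv_mem (hDT hd'))
    obtain ⟨m, hm⟩ := hP.isDiscretePToral.exists_pow_eq_one hs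
    have huP : q * y * q⁻¹ * y⁻¹ * d'⁻¹ ∈ P := hT.mem_of_pow_eq_one hP huT (k := k + m) (by
      rw [pow_add, pow_mul, hu, hm])
    exact (Subgroup.mem_sup_iff_exists_mul hconjPD).2 ⟨_, ⟨huP, huT⟩, d', hd', by group⟩
  obtain ⟨s, hs, d, hd, hsd⟩ :=
    (Subgroup.mem_sup_iff_exists_mul hconjPD).1 (hNpow _ ⟨y, hy⟩ hbrmem)
  -- `N y = s * d * t` for the element `t = y ^ p ^ k`.
  have ht' : y ^ p ^ k = s⁻¹ * ((N ⟨y, hy⟩ : G) * d⁻¹) := by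
    have h1 : (N ⟨y, hy⟩ : G) = s * d * y ^ p ^ k := by rw [hsd]; simp
    rw [h1, mul_assoc s, mul_assoc s, inv_mul_cancel_left,
      hT.isTorus.mul_comm (hDT hd) ht, mul_inv_cancel_right]
  have hmem : (N ⟨y, hy⟩ : G) * d⁻¹ ∈ T₀ := mul_mem (hNT₀ _) (inv_mem (hDT₀ hd))
  refine ⟨x * s⁻¹, ⟨P.mul_mem hx (P.inv_mem hs.1), ?_⟩, _, hmem, by rw [ht', mul_assoc]⟩
  rw [ht', ← mul_assoc] at hg
  exact (mul_mem_cancel_right (hT₀K hmem)).1 hg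

end Subgroups

/-! ### Centralizers and normalizers -/

section Discretization

variable {G : Type*} [Group G] [TopologicalSpace G] [IsTopologicalGroup G]

namespace IsPDiscretization

variable {p : ℕ} {P Q K L : Subgroup G}

theorem centralizer_eq [T2Space G] (hQ : IsPDiscretization p Q K) :
    Subgroup.centralizer (K : Set G) = Subgroup.centralizer (Q : Set G) := by
  refine le_antisymm (Subgroup.centralizer_le hQ.le) fun g hg ↦ ?_
  have hcl : IsClosed {q : G | q * g = g * q} :=
    isClosed_eq (continuous_mul_const g) (continuous_const_mul g)
  have h : closure (Q : Set G) ⊆ {q : G | q * g = g * q} :=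
    closure_minimal (Subgroup.mem_centralizer_iff.1 hg) hcl
  rw [hQ.closure_eq] at h
  exact Subgroup.mem_centralizer_iff.2 h

theorem centralizerIn_eq [T2Space G] (hP : IsPDiscretization p P L) (hQ : IsPDiscretization p Q K) :
    centralizerIn P Q = P ⊓ centralizerIn L K := by
  rw [centralizerIn, centralizerIn, hQ.centralizer_eq, ← inf_assoc, inf_eq_left.2 hP.le]

theorem normalizerIn_eq [Fact p.Prime] (hP : IsPDiscretization p P L)
    (hQ : IsPDiscretization p Q K) (hQP : Q ≤ P) :
    normalizerIn P Q = P ⊓ normalizerIn L K := by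
  rw [normalizerIn, normalizerIn, ← inf_assoc, inf_eq_left.2 hP.le]
  have hconj {g : G} {A : Subgroup G} (hg : g ∈ Subgroup.normalizer (A : Set G)) {x : G} :
      x ∈ A ↔ g * x * g⁻¹ ∈ A := Subgroup.mem_normalizer_iff.1 hg x
  ext g
  refine and_congr_right fun hgP ↦ ⟨fun hg ↦ ?_, fun hg ↦ ?_⟩
  · have key {h : G} (hh : h ∈ Subgroup.normalizer (Q : Set G)) {x : G} (hx : x ∈ K) :
        h * x * h⁻¹ ∈ K := by
      have hc : Continuous fun y : G ↦ h * y * h⁻¹ := by fun_prop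
      have hx' : x ∈ closure (Q : Set G) := hQ.closure_eq ▸ hx
      have := map_mem_closure hc hx' (t := (Q : Set G)) fun q hq ↦ (hconj hh).1 hq
      rwa [hQ.closure_eq] at this
    refine Subgroup.mem_normalizer_iff.2 fun x ↦ ⟨key hg, fun hx ↦ ?_⟩
    have := key (inv_mem hg) hx
    simpa [mul_assoc] using this
  · refine Subgroup.mem_normalizer_iff.2 fun x ↦ ?_
    rw [← hQ.inf_eq hP hQP, Subgroup.mem_inf, Subgroup.mem_inf, ← hconj hg]
    refine and_congr_left fun _ ↦ ⟨fun hx ↦ P.mul_mem (P.mul_mem hgP hx) (P.inv_mem hgP), fun hx ↦ ?_⟩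
    have := P.mul_mem (P.mul_mem (P.inv_mem hgP) hx) hgP
    simpa [mul_assoc] using this

protected theorem centralizerIn [T2Space G] [Fact p.Prime] (hP : IsPDiscretization p P L)
    (hQ : IsPDiscretization p Q K) (hQP : Q ≤ P) :
    IsPDiscretization p (centralizerIn P Q) (centralizerIn L K) := by
  obtain ⟨T, hT⟩ := isPToral_iff_exists_isPToralExtension.1 hP.isPToral
  rw [hP.centralizerIn_eq hQ]
  have hmem {g : G} : g ∈ centralizerIn L K ↔ g ∈ L ∧ ∀ q ∈ Q, q * g = g * q := by
    rw [centralizerIn, Subgroup.mem_inf, hQ.centralizer_eq, Subgroup.mem_centralizer_iff]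
    rfl
  refine hT.isPDiscretization_inf hP hQP isTorus_bot bot_le inf_le_left bot_le
    (fun t ht h ↦ hmem.2 ⟨hT.le ht, fun q hq ↦ mul_inv_eq_iff_eq_mul.1 (h q hq)⟩)
    ⟨0, fun x hx _ q hq ↦ ?_⟩ fun x hx t _ hxt q hq ↦ ?_
  · rw [(hmem.1 hx).2 q hq]
    simp
  · refine ⟨q * x⁻¹ * q⁻¹ * x, mul_mem (mul_mem (mul_mem (hQP hq) (inv_mem hx))
      (inv_mem (hQP hq))) hx, 1, one_mem _, ?_⟩
    have h := (hmem.1 hxt).2 q⁻¹ (inv_mem hq)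
    calc q * t * q⁻¹ * t⁻¹ = q * x⁻¹ * (x * t * q⁻¹) * t⁻¹ := by group
      _ = q * x⁻¹ * q⁻¹ * x * 1 := by rw [← h]; group

protected theorem normalizerIn [T2Space G] [Fact p.Prime] (hP : IsPDiscretization p P L)
    (hQ : IsPDiscretization p Q K) (hQP : Q ≤ P) (hKL : K ≤ L) :
    IsPDiscretization p (normalizerIn P Q) (normalizerIn L K) := by
  obtain ⟨T, hT⟩ := isPToral_iff_exists_isPToralExtension.1 hP.isPToral
  obtain ⟨D, hD⟩ := isPToral_iff_exists_isPToralExtension.1 hQ.isPToral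
  have hp0 (n : ℕ) : p ^ n ≠ 0 := pow_ne_zero _ (Fact.out : p.Prime).ne_zero
  have hDT : D ≤ T := fun d hd ↦ by
    obtain ⟨n, hn⟩ := hT.exists_pow_mem
    obtain ⟨y, hy, rfl⟩ := hD.isTorus.exists_pow_eq (hp0 n) hd
    exact hn y (hKL (hD.le hy))
  obtain ⟨a, ha⟩ := hD.exists_pow_mem
  have hconj {g : G} (hg : g ∈ normalizerIn L K) {x : G} (hx : x ∈ K) : g * x * g⁻¹ ∈ K :=
    (Subgroup.mem_normalizer_iff.1 hg.2 x).1 hx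
  -- `D` consists of the `p ^ a`-th powers in `K`, so it is normalized by the normalizer of `K`.
  have hconjD {g : G} (hg : g ∈ normalizerIn L K) {d : G} (hd : d ∈ D) : g * d * g⁻¹ ∈ D := by
    obtain ⟨y, hy, rfl⟩ := hD.isTorus.exists_pow_eq (hp0 a) hd
    rw [← conj_pow]
    exact ha _ (hconj hg (hD.le hy))
  rw [hP.normalizerIn_eq hQ hQP]
  refine hT.isPDiscretization_inf hP hQP hD.isTorus hDT inf_le_left
    (fun d hd ↦ ⟨hKL (hD.le hd), Subgroup.le_normalizer (hD.le hd)⟩) (fun t ht h ↦ ?_)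
    ⟨a, fun x hx _ q hq ↦ ?_⟩ fun x hx t ht hxt q hq ↦ ?_
  · refine Subgroup.mem_inf.2 ⟨hT.le ht, Subgroup.centralizer_le_normalizer (K : Set G) ?_⟩
    rw [hQ.centralizer_eq]
    exact Subgroup.mem_centralizer_iff.2 fun q hq ↦ mul_inv_eq_iff_eq_mul.1 (h q hq)
  · refine ha _ ?_
    have := mul_mem (hQ.le hq) (hconj hx (inv_mem (hQ.le hq)))
    simpa [mul_assoc] using this
  · -- Conjugation by `x * t` carries `q⁻¹` into `K`, every element of which has the form `u * d`.
    obtain ⟨u, hu, d, hd, hud⟩ :=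
      hD.exists_mul_of_closure_eq hQ.closure_eq (hconj hxt (inv_mem (hQ.le hq)))
    have hd' : x⁻¹ * d * x ∈ D := by
      have h1 := hconjD (inv_mem hxt) hd
      have h2 : x⁻¹ * d * x = t * ((x * t)⁻¹ * d * (x * t)⁻¹⁻¹) * t⁻¹ := by group
      rw [h2, hT.isTorus.mul_comm ht (hDT h1), mul_inv_cancel_right]
      exact h1
    refine ⟨q * x⁻¹ * u * x, mul_mem (mul_mem (mul_mem (hQP hq) (inv_mem hx)) (hQP hu)) hx,
      _, hd', ?_⟩
    calc q * t * q⁻¹ * t⁻¹ = q * x⁻¹ * (x * t * q⁻¹ * (x * t)⁻¹) * x := by group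
      _ = q * x⁻¹ * u * x * (x⁻¹ * d * x) := by rw [hud]; group

end IsPDiscretization

end Discretization

theorem centerOf_eq_centralizerIn {G : Type*} [Group G] (P : Subgroup G) :
    centerOf P = centralizerIn P P := by
  ext g
  simp only [centerOf, centralizerIn, Subgroup.mem_map, Subgroup.mem_inf,
    Subgroup.mem_center_iff, Subgroup.mem_centralizer_iff]
  constructor
  · rintro ⟨x, hx, rfl⟩
    exact ⟨x.2, fun y hy ↦ congrArg Subtype.val (hx ⟨y, hy⟩)⟩
  · rintro ⟨hg, h⟩
    exact ⟨⟨g, hg⟩, fun y ↦ Subtype.ext (h y y.2), rfl⟩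

theorem mainTheorem6 (p : ℕ) [Fact p.Prime]
    {E : Type*} [NormedAddCommGroup E] [NormedSpace ℝ E] [FiniteDimensional ℝ E]
    {H : Type*} [TopologicalSpace H] (I : ModelWithCorners ℝ E H) [I.Boundaryless]
    {G : Type*} [Group G] [TopologicalSpace G] [ChartedSpace H G] [LieGroup I ∞ G]
    [CompactSpace G] [T2Space G] :
    (∀ Q P Qbold Pbold : Subgroup G, Q ≤ P → Qbold ≤ Pbold →
      IsPDiscretization p Q Qbold → IsPDiscretization p P Pbold →
        IsPDiscretization p (centralizerIn P Q) (centralizerIn Pbold Qbold) ∧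
        IsPDiscretization p (normalizerIn P Q) (normalizerIn Pbold Qbold)) ∧
    (∀ P Pbold : Subgroup G, IsPDiscretization p P Pbold →
      IsPDiscretization p (centerOf P) (centerOf Pbold)) := by
  have : IsTopologicalGroup G := topologicalGroup_of_lieGroup I ∞
  refine ⟨fun Q P K L hQP hKL hQ hP ↦ ⟨hP.centralizerIn hQ hQP, hP.normalizerIn hQ hQP hKL⟩,
    fun P L hP ↦ ?_⟩
  rw [centerOf_eq_centralizerIn, centerOf_eq_centralizerIn]
  exact hP.centralizerIn hP le_rfl
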